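/- Throughout, systems are finite-dimensional, $H(\rho)=-\operatorname{Tr}[\rho\log_2\rho]$ is the von Neumann entropy, and a quantum channel is a completely positive trace-preserving linear map. For a channel $\mathcal N$ and a finite ensemble $E=\{p_x,\rho_x\}_x$ of density matrices on its input system, let $$\chi(\mathcal N,E)=H\Big(\mathcal N\big(\textstyle\sum_x p_x\rho_x\big)\Big)-\sum_x p_x\,H\big(\mathcal N(\rho_x)\big),\qquad \chi(\mathcal N)=\max_E \chi(\mathcal N,E)$$ (the Holevo information of $\mathcal N$), and let the classical capacity of $\mathcal N$ be $C(\mathcal N)=\lim_{n\to\infty}\frac1n\chi(\mathcal N^{\otimes n})$. Let $\{\mathcal C_l\}_{l\in\mathsf L}$ be a finite collection of quantum channels from a system $A$ to a system $B$, let $p$ be a probability distribution on $\mathsf L$, and let $$\mathcal D(\cdot)=\sum_{l} p(l)\,\mathcal C_l(\cdot)\otimes|l\rangle\langle l|$$ be the labeled random channel, where $\{|l\rangle\}_{l\in\mathsf L}$ is an orthonormal basis of the label system. Suppose that there is a single ensemble $E$ on $A$ with $\chi(\mathcal C_l,E)=\chi(\mathcal C_l)$ for every $l$. Then $$\chi(\mathcal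 D)=\sum_l p(l)\,\chi(\mathcal C_l).$$ If, in addition, Holevo additivity holds among the channels $\mathcal C_l$, that is, $$\chi(\mathcal C_{l_1}\otimes\cdots\otimes\mathcal C_{l_n})=\chi(\mathcal C_{l_1})+\cdots+\chi(\mathcal C_{l_n})\quad\text{for all } n \text{ and all } l_1,\dots,l_n\in\mathsf L,$$ then the limit defining the classical capacity of $\mathcal D$ exists and $C(\mathcal D)=\chi(\mathcal D)$. -/

import Mathlib

open Matrix Filter Topology
open scoped Kronecker ComplexOrder

/-- A density matrix of the finite-dimensional system `ℂ^A`. -/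
structure IsDensityMatrix {A : Type*} [Fintype A] (ρ : Matrix A A ℂ) : Prop where
  posSemidef : ρ.PosSemidef
  trace_eq_one : ρ.trace = 1

/-- The von Neumann entropy `H(ρ) = - Tr[ρ log ρ]`, in bits, with `log ρ` given by the functional
calculus. As `logb 2 0 = 0`, the usual convention `0 log 0 = 0` is in force. -/
noncomputable def vonNeumannEntropy {B : Type*} [Fintype B] [DecidableEq B]
    (ρ : Matrix B B ℂ) : ℝ :=
  -((ρ * cfc (Real.logb 2) ρ).trace).re

theorem vonNeumannEntropy_eq_sum {B : Type*} [Fintype B] [DecidableEq B]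
    {ρ : Matrix B B ℂ} (h : ρ.IsHermitian) :
    vonNeumannEntropy ρ = (∑ i, Real.negMulLog (h.eigenvalues i)) / Real.log 2 := by
  have h1 : ρ * cfc (Real.logb 2) ρ = cfc (fun x => x * Real.logb 2 x) ρ := by
    have hf : ∀ f : ℝ → ℝ, ContinuousOn f (spectrum ℝ ρ) := fun f =>
      (Matrix.finite_real_spectrum (A := ρ)).continuousOn f
    rw [cfc_mul (fun x => x) _ ρ (hf _) (hf _)]
    congr 1
    exact (cfc_id' ℝ ρ h).symm
  rw [vonNeumannEntropy, h1, h.cfc_eq, Matrix.IsHermitian.cfc, Unitary.conjStarAlgAut_apply,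
    Matrix.trace_mul_cycle]
  simp only [Matrix.trace, Matrix.diag_apply, Complex.re_sum, Finset.sum_div,
    ← Finset.sum_neg_distrib, Unitary.coe_star_mul_self, one_mul, Matrix.diagonal_apply_eq,
    Function.comp_apply, Complex.coe_algebraMap, Complex.ofReal_re, Real.logb, Real.negMulLog]
  exact Finset.sum_congr rfl fun i _ => by ring

theorem IsDensityMatrix.sum_eigenvalues {B : Type*} [Fintype B] [DecidableEq B]
    {ρ : Matrix B B ℂ} (h : IsDensityMatrix ρ) : ∑ i, h.posSemidef.1.eigenvalues i = 1 := by
  have := h.posSemidef.1.trace_eq_sum_eigenvalues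
  rw [h.trace_eq_one] at this
  have h2 := congrArg Complex.re this
  simpa using h2.symm

theorem IsDensityMatrix.vonNeumannEntropy_nonneg {B : Type*} [Fintype B] [DecidableEq B]
    {ρ : Matrix B B ℂ} (h : IsDensityMatrix ρ) : 0 ≤ vonNeumannEntropy ρ := by
  rw [vonNeumannEntropy_eq_sum h.posSemidef.1]
  refine div_nonneg (Finset.sum_nonneg fun i _ => ?_) (Real.log_nonneg (by norm_num))
  have h0 := h.posSemidef.eigenvalues_nonneg
  refine Real.negMulLog_nonneg (h0 i) ?_
  rw [← h.sum_eigenvalues]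
  exact Finset.single_le_sum (fun j _ => h0 j) (Finset.mem_univ i)

/-- A crude dimension bound on the entropy. -/
theorem IsDensityMatrix.vonNeumannEntropy_le {B : Type*} [Fintype B] [DecidableEq B]
    {ρ : Matrix B B ℂ} (h : IsDensityMatrix ρ) :
    vonNeumannEntropy ρ ≤ Fintype.card B / Real.log 2 := by
  rw [vonNeumannEntropy_eq_sum h.posSemidef.1]
  refine div_le_div_of_nonneg_right ?_ (Real.log_nonneg (by norm_num))
  have : ∀ i, Real.negMulLog (h.posSemidef.1.eigenvalues i) ≤ 1 := fun i => by
    rcases (h.posSemidef.eigenvalues_nonneg i).eq_or_lt with h0 | h0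
    · rw [← h0]; simp
    · have h2 := Real.log_le_sub_one_of_pos (inv_pos.2 h0)
      rw [Real.log_inv] at h2
      have h3 := mul_le_mul_of_nonneg_left h2 h0.le
      rw [mul_sub, mul_inv_cancel₀ h0.ne'] at h3
      rw [Real.negMulLog]
      linarith
  calc _ ≤ ∑ _i : B, (1 : ℝ) := Finset.sum_le_sum fun i _ => this i
    _ = _ := by simp

/-- A quantum channel from the system `ℂ^A` to the system `ℂ^B`: a linear map on matrices with a
Kraus representation `X ↦ ∑ i, K i * X * (K i)ᴴ`, `∑ i, (K i)ᴴ * K i = 1` (equivalently, a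
completely positive trace-preserving linear map). -/
structure QuantumChannel (A B : Type*) [Fintype A] [DecidableEq A] [Fintype B] where
  toLinearMap : Matrix A A ℂ →ₗ[ℂ] Matrix B B ℂ
  exists_kraus : ∃ (r : ℕ) (K : Fin r → Matrix B A ℂ),
    ∑ i, (K i)ᴴ * K i = 1 ∧ ∀ X, toLinearMap X = ∑ i, K i * X * (K i)ᴴ

/-- A finite ensemble `(p_x, ρ_x)` of density matrices. -/
structure Ensemble (A : Type*) [Fintype A] where
  size : ℕ
  prob : Fin size → ℝ
  prob_mem : prob ∈ stdSimplex ℝ (Fin size)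
  state : Fin size → Matrix A A ℂ
  isDensityMatrix_state : ∀ x, IsDensityMatrix (state x)

/-- The average state `∑ x, p_x ρ_x` of an ensemble. -/
def Ensemble.average {A : Type*} [Fintype A] (E : Ensemble A) : Matrix A A ℂ :=
  ∑ x, (E.prob x : ℂ) • E.state x

theorem Ensemble.isDensityMatrix_average {A : Type*} [Fintype A] (E : Ensemble A) :
    IsDensityMatrix E.average where
  posSemidef := Matrix.posSemidef_sum _ fun x _ =>
    (E.isDensityMatrix_state x).posSemidef.smul (by exact_mod_cast E.prob_mem.1 x)
  trace_eq_one := by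
    simp only [Ensemble.average, Matrix.trace_sum, Matrix.trace_smul,
      (E.isDensityMatrix_state _).trace_eq_one, smul_eq_mul, mul_one]
    exact_mod_cast E.prob_mem.2

namespace QuantumChannel

theorem isDensityMatrix_apply {A B : Type*} [Fintype A] [DecidableEq A] [Fintype B]
    (N : QuantumChannel A B) {ρ : Matrix A A ℂ} (h : IsDensityMatrix ρ) :
    IsDensityMatrix (N.toLinearMap ρ) := by
  obtain ⟨r, K, hK, hN⟩ := N.exists_kraus
  rw [hN]
  refine ⟨Matrix.posSemidef_sum _ fun i _ => h.posSemidef.mul_mul_conjTranspose_same _, ?_⟩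
  have : ∀ i, (K i * ρ * (K i)ᴴ).trace = ((K i)ᴴ * K i * ρ).trace := fun i => by
    rw [Matrix.trace_mul_cycle]
  simp only [Matrix.trace_sum, this]
  rw [← Matrix.trace_sum, ← Finset.sum_mul, hK, one_mul, h.trace_eq_one]

/-- A Kraus representation may be indexed by any finite type. -/
theorem exists_kraus_of_fintype {A B : Type*} [Fintype A] [DecidableEq A] [Fintype B]
    (Φ : Matrix A A ℂ →ₗ[ℂ] Matrix B B ℂ) {κ : Type*} [Fintype κ] (K : κ → Matrix B A ℂ)
    (hK : ∑ i, (K i)ᴴ * K i = 1) (hΦ : ∀ X, Φ X = ∑ i, K i * X * (K i)ᴴ) :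
    ∃ (r : ℕ) (K : Fin r → Matrix B A ℂ),
      ∑ i, (K i)ᴴ * K i = 1 ∧ ∀ X, Φ X = ∑ i, K i * X * (K i)ᴴ := by
  refine ⟨Fintype.card κ, fun i => K ((Fintype.equivFin κ).symm i), ?_, fun X => ?_⟩
  · rw [← hK]
    exact (Fintype.equivFin κ).symm.sum_comp (fun i => (K i)ᴴ * K i)
  · rw [hΦ]
    exact ((Fintype.equivFin κ).symm.sum_comp (fun i => K i * X * (K i)ᴴ)).symm

section Holevo

variable {A B : Type*} [Fintype A] [DecidableEq A] [Fintype B] [DecidableEq B]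

/-- The Holevo quantity `H(N(∑ x, p_x ρ_x)) - ∑ x, p_x H(N(ρ_x))` of an input ensemble. -/
noncomputable def holevoQuantity (N : QuantumChannel A B) (E : Ensemble A) : ℝ :=
  vonNeumannEntropy (N.toLinearMap E.average)
    - ∑ x, E.prob x * vonNeumannEntropy (N.toLinearMap (E.state x))

/-- The Holevo information `χ(N)`: the optimum of the Holevo quantity over all finite ensembles. -/
noncomputable def holevoInformation (N : QuantumChannel A B) : ℝ :=
  ⨆ E : Ensemble A, N.holevoQuantity E

/-- The Holevo quantities of a channel are bounded, so that `holevoInformation` is a genuine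
supremum whenever the input system has a state. -/
theorem bddAbove_holevoQuantity (N : QuantumChannel A B) :
    BddAbove (Set.range N.holevoQuantity) := by
  refine ⟨Fintype.card B / Real.log 2, ?_⟩
  rintro _ ⟨E, rfl⟩
  have h1 := (N.isDensityMatrix_apply E.isDensityMatrix_average).vonNeumannEntropy_le
  have h2 : 0 ≤ ∑ x, E.prob x * vonNeumannEntropy (N.toLinearMap (E.state x)) :=
    Finset.sum_nonneg fun x _ => mul_nonneg (E.prob_mem.1 x)
      (N.isDensityMatrix_apply (E.isDensityMatrix_state x)).vonNeumannEntropy_nonneg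
  unfold holevoQuantity
  linarith

end Holevo

section Tensor

variable {ι A B : Type*} [Fintype ι] [DecidableEq ι] [Fintype A] [DecidableEq A] [Fintype B]

/-- The linear map underlying `⨂ k, C k`, written out on matrix units; the space `(ℂ^A)^{⊗ι}` is
`ℂ^(ι → A)`. -/
def tensorLinearMap (C : ι → QuantumChannel A B) :
    Matrix (ι → A) (ι → A) ℂ →ₗ[ℂ] Matrix (ι → B) (ι → B) ℂ where
  toFun X := Matrix.of fun b b' =>
    ∑ a, ∑ a', X a a' * ∏ k, (C k).toLinearMap (Matrix.single (a k) (a' k) 1) (b k) (b' k)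
  map_add' X Y := by
    ext b b'
    simp [add_mul, Finset.sum_add_distrib]
  map_smul' c X := by
    ext b b'
    simp [Finset.mul_sum, mul_assoc]

/-- `⨂ k, C k` maps `⨂ k, X k` to `⨂ k, C k (X k)`. -/
theorem tensorLinearMap_apply_prod (C : ι → QuantumChannel A B) (X : ι → Matrix A A ℂ) :
    tensorLinearMap C (Matrix.of fun a a' => ∏ k, X k (a k) (a' k))
      = Matrix.of fun b b' => ∏ k, (C k).toLinearMap (X k) (b k) (b' k) := by
  ext b b'
  have h : ∀ k, (C k).toLinearMap (X k) (b k) (b' k)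
      = ∑ a, ∑ a', X k a a' * (C k).toLinearMap (Matrix.single a a' 1) (b k) (b' k) := by
    intro k
    conv_lhs => rw [Matrix.matrix_eq_sum_single (X k)]
    simp only [map_sum, Matrix.sum_apply]
    refine Finset.sum_congr rfl fun a _ => Finset.sum_congr rfl fun a' _ => ?_
    have : Matrix.single a a' (X k a a') = X k a a' • Matrix.single a a' (1 : ℂ) := by simp
    rw [this, map_smul, Matrix.smul_apply, smul_eq_mul]
  simp only [tensorLinearMap, LinearMap.coe_mk, AddHom.coe_mk, Matrix.of_apply, h,
    Fintype.prod_sum, ← Finset.prod_mul_distrib]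

theorem exists_kraus_tensorLinearMap (C : ι → QuantumChannel A B) :
    ∃ (r : ℕ) (K : Fin r → Matrix (ι → B) (ι → A) ℂ),
      ∑ i, (K i)ᴴ * K i = 1 ∧ ∀ X, tensorLinearMap C X = ∑ i, K i * X * (K i)ᴴ := by
  choose r K hK hC using fun k => (C k).exists_kraus
  refine exists_kraus_of_fintype (tensorLinearMap C) (κ := (k : ι) → Fin (r k))
    (fun f => Matrix.of fun b a => ∏ k, K k (f k) (b k) (a k)) ?_ fun X => ?_
  · ext a a'
    have h : ∀ k, ∑ j, ∑ b, star (K k j b (a k)) * K k j b (a' k)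
        = (1 : Matrix A A ℂ) (a k) (a' k) := by
      intro k
      rw [← hK k]
      simp [Matrix.sum_apply, Matrix.mul_apply, Matrix.conjTranspose_apply]
    simp only [Matrix.sum_apply, Matrix.mul_apply, Matrix.conjTranspose_apply, Matrix.of_apply,
      star_prod, ← Finset.prod_mul_distrib]
    rw [show (1 : Matrix (ι → A) (ι → A) ℂ) a a' = ∏ k, (1 : Matrix A A ℂ) (a k) (a' k) by
      simp [Matrix.one_apply, Finset.prod_ite_zero, funext_iff]]
    simp only [← h, Fintype.prod_sum]
  · ext b b'
    have h : ∀ k (x y : A), (C k).toLinearMap (Matrix.single x y 1) (b k) (b' k)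
        = ∑ j, K k j (b k) x * star (K k j (b' k) y) := by
      intro k x y
      rw [hC]
      simp [Matrix.sum_apply, Matrix.mul_apply, Matrix.single_apply, ite_and]
    simp only [tensorLinearMap, LinearMap.coe_mk, AddHom.coe_mk, Matrix.of_apply, h,
      Fintype.prod_sum, Matrix.sum_apply, Matrix.mul_apply, Matrix.conjTranspose_apply, star_prod,
      Finset.prod_mul_distrib, Finset.mul_sum, Finset.sum_mul]
    rw [Finset.sum_comm]
    conv_lhs => enter [2, x]; rw [Finset.sum_comm]
    rw [Finset.sum_comm]
    refine Finset.sum_congr rfl fun f _ => Finset.sum_congr rfl fun a' _ =>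
      Finset.sum_congr rfl fun a _ => ?_
    ring

/-- The tensor product `⨂ k, C k` of finitely many channels. -/
def tensor (C : ι → QuantumChannel A B) : QuantumChannel (ι → A) (ι → B) where
  toLinearMap := tensorLinearMap C
  exists_kraus := exists_kraus_tensorLinearMap C

/-- The `n`-fold tensor power `N^{⊗n}`. -/
def tensorPower (N : QuantumChannel A B) (n : ℕ) :
    QuantumChannel (Fin n → A) (Fin n → B) :=
  tensor fun _ => N

end Tensor

/-- The classical capacity `C(N) = lim_{n → ∞} χ(N^{⊗n}) / n`, in bits per use of the channel. -/
noncomputable def classicalCapacity {A B : Type*} [Fintype A] [DecidableEq A] [Fintype B]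
    [DecidableEq B] (N : QuantumChannel A B) : ℝ :=
  limUnder atTop fun n : ℕ => (N.tensorPower n).holevoInformation / n

section LabeledRandom

variable {A B L : Type*} [Fintype A] [DecidableEq A] [Fintype B] [Fintype L] [DecidableEq L]

/-- The linear map `X ↦ ∑ l, p l • (C l X ⊗ |l⟩⟨l|)`. -/
def labeledRandomLinearMap (p : L → ℝ) (C : L → QuantumChannel A B) :
    Matrix A A ℂ →ₗ[ℂ] Matrix (B × L) (B × L) ℂ where
  toFun X := ∑ l, (p l : ℂ) • ((C l).toLinearMap X ⊗ₖ Matrix.single l l (1 : ℂ))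
  map_add' X Y := by
    simp [Matrix.add_kronecker, Finset.sum_add_distrib]
  map_smul' c X := by
    simp [Matrix.smul_kronecker, Finset.smul_sum, smul_comm c]

theorem exists_kraus_labeledRandomLinearMap (p : L → ℝ) (hp : p ∈ stdSimplex ℝ L)
    (C : L → QuantumChannel A B) :
    ∃ (r : ℕ) (K : Fin r → Matrix (B × L) A ℂ),
      ∑ i, (K i)ᴴ * K i = 1 ∧ ∀ X, labeledRandomLinearMap p C X = ∑ i, K i * X * (K i)ᴴ := by
  choose r K hK hC using fun l => (C l).exists_kraus
  have hs : ∀ l, (Real.sqrt (p l) : ℂ) * (Real.sqrt (p l) : ℂ) = p l := fun l => by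
    rw [← Complex.ofReal_mul, Real.mul_self_sqrt (hp.1 l)]
  refine exists_kraus_of_fintype (labeledRandomLinearMap p C) (κ := (l : L) × Fin (r l))
    (fun j => Matrix.of fun bl a =>
      if bl.2 = j.1 then (Real.sqrt (p j.1) : ℂ) * K j.1 j.2 bl.1 a else 0) ?_ fun X => ?_
  · have h : ∀ l i, (Matrix.of fun (bl : B × L) a =>
        if bl.2 = l then (Real.sqrt (p l) : ℂ) * K l i bl.1 a else 0)ᴴ *
        (Matrix.of fun (bl : B × L) a =>
        if bl.2 = l then (Real.sqrt (p l) : ℂ) * K l i bl.1 a else 0)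
        = (p l : ℂ) • ((K l i)ᴴ * K l i) := by
      intro l i
      ext a a'
      simp only [Matrix.mul_apply, Matrix.conjTranspose_apply, Matrix.of_apply,
        Fintype.sum_prod_type, Matrix.smul_apply, smul_eq_mul, Finset.mul_sum]
      refine Finset.sum_congr rfl fun b _ => ?_
      rw [← hs l]
      simp
      ring
    rw [Fintype.sum_sigma]
    simp only [h, ← Finset.smul_sum, hK]
    rw [← Finset.sum_smul, ← Complex.ofReal_sum, hp.2]
    simp
  · ext ⟨b, l⟩ ⟨b', l'⟩
    simp only [labeledRandomLinearMap, LinearMap.coe_mk, AddHom.coe_mk, Matrix.sum_apply,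
      Matrix.smul_apply, smul_eq_mul, Matrix.kroneckerMap_apply, Fintype.sum_sigma, hC, ← hs]
    refine Finset.sum_congr rfl fun m _ => ?_
    rw [Finset.sum_mul, Finset.mul_sum]
    refine Finset.sum_congr rfl fun i _ => ?_
    by_cases h1 : l = m <;> by_cases h2 : l' = m <;>
      simp [Matrix.mul_apply, h1, h2, eq_comm, Finset.mul_sum, Finset.sum_mul]
    refine Finset.sum_congr rfl fun a' _ => Finset.sum_congr rfl fun a _ => ?_
    ring

/-- The labeled random channel `∑ l, p l • C l (·) ⊗ |l⟩⟨l|`. -/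
def labeledRandom (p : L → ℝ) (hp : p ∈ stdSimplex ℝ L) (C : L → QuantumChannel A B) :
    QuantumChannel A (B × L) where
  toLinearMap := labeledRandomLinearMap p C
  exists_kraus := exists_kraus_labeledRandomLinearMap p hp C

end LabeledRandom

/-- Holevo additivity among the channels `C l`: the Holevo information is additive on every finite
tensor product, repetitions allowed, of channels of the collection. -/
def HolevoAdditive {A B L : Type*} [Fintype A] [DecidableEq A] [Fintype B] [DecidableEq B]
    (C : L → QuantumChannel A B) : Prop :=
  ∀ (n : ℕ) (w : Fin n → L),
    (tensor fun k => C (w k)).holevoInformation = ∑ k, (C (w k)).holevoInformation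

end QuantumChannel

/-!
The label is readable, so the entropy of an output of the labeled random channel `D` is the entropy
of the label plus the average of the output entropies of the `C l`. The label entropy cancels in the
Holevo quantity, which gives `χ(D, E) = ∑ l, p l * χ(C l, E)` for every ensemble `E`; an ensemble
optimal for every `C l` maximizes all the summands at once.

Up to the order of the tensor factors, `D^{⊗n}` is again a labeled random channel, over the product
channels `C (w 1) ⊗ ⋯ ⊗ C (w n)`. Holevo quantities add up over product ensembles, so under Holevo
additivity `E^{⊗n}` is optimal for all these product channels. The formula for `D` then applies to
`D^{⊗n}` and gives `χ(D^{⊗n}) = n * χ(D)`.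
-/

section ProductDistribution

variable {ι R : Type*} {X : ι → Type*} [Fintype ι] [DecidableEq ι] [∀ k, Fintype (X k)]
  [CommSemiring R]

theorem sum_prod_mul_apply (q f : ∀ k, X k → R) (hq : ∀ k, ∑ x, q k x = 1) (k : ι) :
    ∑ x : ∀ j, X j, (∏ j, q j (x j)) * f k (x k) = ∑ x, q k x * f k x := by
  have hmul : ∀ x : ∀ j, X j, (∏ j, q j (x j)) * f k (x k)
      = ∏ j, q j (x j) * if j = k then f j (x j) else 1 := fun x => by
    rw [Finset.prod_mul_distrib, Fintype.prod_ite_eq']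
  have hfactor : ∀ j ≠ k, ∑ x, q j x * (if j = k then f j x else 1) = 1 := fun j hj => by
    simp only [if_neg hj, mul_one, hq]
  simp only [hmul]
  rw [← Fintype.prod_sum fun j x => q j x * if j = k then f j x else 1,
    Fintype.prod_eq_single k hfactor]
  simp only [if_true]

theorem sum_prod_mul_sum (q f : ∀ k, X k → R) (hq : ∀ k, ∑ x, q k x = 1) :
    ∑ x : ∀ k, X k, (∏ k, q k (x k)) * ∑ k, f k (x k) = ∑ k, ∑ x, q k x * f k x := by
  simp only [Finset.mul_sum]
  rw [Finset.sum_comm]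
  exact Finset.sum_congr rfl fun k _ => sum_prod_mul_apply q f hq k

theorem prod_mem_stdSimplex [PartialOrder R] [IsOrderedRing R] {p : ∀ k, X k → R}
    (hp : ∀ k, p k ∈ stdSimplex R (X k)) :
    (fun x : ∀ k, X k => ∏ k, p k (x k)) ∈ stdSimplex R (∀ k, X k) :=
  ⟨fun x => Finset.prod_nonneg fun k _ => (hp k).1 (x k), by
    simp only [← Fintype.prod_sum, (hp _).2, Finset.prod_const_one]⟩

end ProductDistribution

section ShannonEntropy

variable {X : Type*} [Fintype X]

/-- The Shannon entropy, in bits, of the family of weights `p`. The weights need not add up to one,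
so that the eigenvalues of any Hermitian matrix may serve as weights. -/
noncomputable def shannonEntropy (p : X → ℝ) : ℝ :=
  (∑ x, Real.negMulLog (p x)) / Real.log 2

theorem shannonEntropy_const_mul (c : ℝ) (p : X → ℝ) :
    shannonEntropy (fun x => c * p x)
      = c * shannonEntropy p + (∑ x, p x) * (Real.negMulLog c / Real.log 2) := by
  simp only [shannonEntropy, Real.negMulLog_mul, Finset.sum_add_distrib, ← Finset.mul_sum,
    ← Finset.sum_mul]
  ring

theorem shannonEntropy_prod_type {Y : Type*} [Fintype Y] (p : Y → X → ℝ) :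
    shannonEntropy (fun x : X × Y => p x.2 x.1) = ∑ y, shannonEntropy (p y) := by
  simp only [shannonEntropy, Fintype.sum_prod_type_right, Finset.sum_div]

theorem negMulLog_prod {ι : Type*} [Fintype ι] (a : ι → ℝ) :
    Real.negMulLog (∏ k, a k) = (∏ k, a k) * ∑ k, -Real.log (a k) := by
  by_cases ha : ∏ k, a k = 0
  · simp only [ha, Real.negMulLog_zero, zero_mul]
  · rw [Real.negMulLog, Real.log_prod fun k hk => Finset.prod_ne_zero_iff.1 ha k hk,
      Finset.sum_neg_distrib, neg_mul_comm]

theorem shannonEntropy_prod {ι : Type*} {Y : ι → Type*} [Fintype ι] [DecidableEq ι]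
    [∀ k, Fintype (Y k)] (p : ∀ k, Y k → ℝ) (hp : ∀ k, ∑ y, p k y = 1) :
    shannonEntropy (fun y : ∀ k, Y k => ∏ k, p k (y k)) = ∑ k, shannonEntropy (p k) := by
  simp only [shannonEntropy, negMulLog_prod]
  rw [sum_prod_mul_sum p (fun k y => -Real.log (p k y)) hp, Finset.sum_div]
  simp only [Real.negMulLog, neg_mul_comm]

end ShannonEntropy

section PiKronecker

variable {ι R : Type*} {A B D X : ι → Type*} [Fintype ι]

/-- The Kronecker product `⨂ k, M k` of a finite family of matrices. Its rows and columns are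
indexed by dependent functions, in accordance with `QuantumChannel.tensorLinearMap`. -/
def piKronecker [CommMonoid R] (M : ∀ k, Matrix (A k) (B k) R) :
    Matrix (∀ k, A k) (∀ k, B k) R :=
  Matrix.of fun a b => ∏ k, M k (a k) (b k)

theorem conjTranspose_piKronecker [CommMonoid R] [StarMul R] (M : ∀ k, Matrix (A k) (B k) R) :
    (piKronecker M)ᴴ = piKronecker fun k => (M k)ᴴ := by
  ext b a
  exact star_prod Finset.univ fun k => M k (a k) (b k)

theorem piKronecker_smul [CommMonoid R] (c : ι → R) (M : ∀ k, Matrix (A k) (B k) R) :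
    (piKronecker fun k => c k • M k) = (∏ k, c k) • piKronecker M := by
  ext a b
  exact Finset.prod_mul_distrib

theorem piKronecker_diagonal [CommMonoidWithZero R] [∀ k, DecidableEq (A k)]
    (d : ∀ k, A k → R) :
    (piKronecker fun k => diagonal (d k)) = diagonal fun a => ∏ k, d k (a k) := by
  ext a a'
  simp only [piKronecker, Matrix.of_apply, Matrix.diagonal_apply, Finset.prod_ite_zero,
    Finset.mem_univ, true_imp_iff, funext_iff]

theorem piKronecker_one [CommMonoidWithZero R] [∀ k, DecidableEq (A k)] :
    (piKronecker fun k => (1 : Matrix (A k) (A k) R)) = 1 := by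
  simp only [← Matrix.diagonal_one, piKronecker_diagonal, Finset.prod_const_one]

variable [DecidableEq ι] [CommSemiring R]

theorem piKronecker_mul [∀ k, Fintype (B k)] (M : ∀ k, Matrix (A k) (B k) R)
    (N : ∀ k, Matrix (B k) (D k) R) :
    piKronecker M * piKronecker N = piKronecker fun k => M k * N k := by
  ext a d
  simp only [piKronecker, Matrix.mul_apply, Matrix.of_apply, ← Finset.prod_mul_distrib,
    Fintype.prod_sum]

theorem piKronecker_sum [∀ k, Fintype (X k)] (M : ∀ k, X k → Matrix (A k) (B k) R) :
    (piKronecker fun k => ∑ x, M k x) = ∑ x : ∀ k, X k, piKronecker fun k => M k (x k) := by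
  ext a b
  simp only [piKronecker, Matrix.sum_apply, Matrix.of_apply, Fintype.prod_sum]

theorem trace_piKronecker [∀ k, Fintype (A k)] (M : ∀ k, Matrix (A k) (A k) R) :
    (piKronecker M).trace = ∏ k, (M k).trace := by
  simp only [Matrix.trace, Matrix.diag_apply, piKronecker, Matrix.of_apply, Fintype.prod_sum]

end PiKronecker

open scoped MatrixOrder Matrix.Norms.L2Operator in
theorem posSemidef_piKronecker {ι 𝕜 : Type*} {A : ι → Type*} [Fintype ι] [RCLike 𝕜]
    [∀ k, Finite (A k)] {M : ∀ k, Matrix (A k) (A k) 𝕜} (hM : ∀ k, (M k).PosSemidef) :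
    (piKronecker M).PosSemidef := by
  classical
  have := fun k => Fintype.ofFinite (A k)
  choose N hN using fun k => CStarAlgebra.nonneg_iff_eq_star_mul_self.1 (hM k).nonneg
  obtain rfl : M = fun k => (N k)ᴴ * N k := funext hN
  rw [← piKronecker_mul, ← conjTranspose_piKronecker]
  exact Matrix.posSemidef_conjTranspose_mul_self _

theorem IsDensityMatrix.piKronecker {ι : Type*} {A : ι → Type*} [Fintype ι] [DecidableEq ι]
    [∀ k, Fintype (A k)] {ρ : ∀ k, Matrix (A k) (A k) ℂ} (hρ : ∀ k, IsDensityMatrix (ρ k)) :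
    IsDensityMatrix (piKronecker ρ) where
  posSemidef := posSemidef_piKronecker fun k => (hρ k).posSemidef
  trace_eq_one := by simp only [trace_piKronecker, (hρ _).trace_eq_one, Finset.prod_const_one]

theorem sum_kronecker_single_eq_blockDiagonal {R m n L : Type*} [NonAssocSemiring R] [Fintype L]
    [DecidableEq L] (M : L → Matrix m n R) :
    ∑ l, M l ⊗ₖ Matrix.single l l (1 : R) = blockDiagonal M := by
  ext ⟨a, l⟩ ⟨b, l'⟩
  rw [Matrix.sum_apply, Fintype.sum_eq_single l fun k hk => by simp [hk]]
  simp [Matrix.single_apply, Matrix.blockDiagonal_apply]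

section VonNeumannEntropy

variable {B : Type*} [Fintype B] [DecidableEq B]

theorem sum_eigenvalues_eq_of_charpoly_eq {𝕜 X : Type*} [RCLike 𝕜] [Fintype X]
    {ρ : Matrix B B 𝕜} (hρ : ρ.IsHermitian) {d : X → ℝ}
    (hd : ρ.charpoly = ∏ x, (Polynomial.X - Polynomial.C (d x : 𝕜))) (f : ℝ → ℝ) :
    ∑ i, f (hρ.eigenvalues i) = ∑ x, f (d x) := by
  have hroots : Finset.univ.val.map (fun x => (d x : 𝕜))
      = Finset.univ.val.map fun i => (hρ.eigenvalues i : 𝕜) := by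
    rw [← Polynomial.roots_multiset_prod_X_sub_C (Finset.univ.val.map fun x => (d x : 𝕜)),
      Multiset.map_map]
    exact (congrArg Polynomial.roots hd).symm.trans hρ.roots_charpoly_eq_eigenvalues
  simpa using congrArg (fun s => (s.map fun z => f (RCLike.re z)).sum) hroots.symm

theorem vonNeumannEntropy_eq_of_charpoly_eq {X : Type*} [Fintype X] {ρ : Matrix B B ℂ}
    (hρ : ρ.IsHermitian) {d : X → ℝ}
    (hd : ρ.charpoly = ∏ x, (Polynomial.X - Polynomial.C (d x : ℂ))) :
    vonNeumannEntropy ρ = shannonEntropy d := by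
  rw [vonNeumannEntropy_eq_sum hρ, sum_eigenvalues_eq_of_charpoly_eq hρ hd, shannonEntropy]

theorem vonNeumannEntropy_eq_shannonEntropy_eigenvalues {ρ : Matrix B B ℂ}
    (hρ : ρ.IsHermitian) : vonNeumannEntropy ρ = shannonEntropy hρ.eigenvalues :=
  vonNeumannEntropy_eq_sum hρ

theorem vonNeumannEntropy_submatrix_equiv {D : Type*} [Fintype D] [DecidableEq D]
    {ρ : Matrix B B ℂ} (hρ : ρ.IsHermitian) (e : D ≃ B) :
    vonNeumannEntropy (ρ.submatrix e e) = vonNeumannEntropy ρ := by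
  rw [vonNeumannEntropy_eq_shannonEntropy_eigenvalues hρ]
  exact vonNeumannEntropy_eq_of_charpoly_eq (hρ.submatrix e)
    ((Matrix.charpoly_reindex e.symm ρ).trans hρ.charpoly_eq)

theorem vonNeumannEntropy_conj_diagonal {U : Matrix B B ℂ} (hU : Uᴴ * U = 1) (d : B → ℝ) :
    vonNeumannEntropy (U * diagonal (fun i => (d i : ℂ)) * Uᴴ) = shannonEntropy d := by
  have hdiag : (diagonal fun i => (d i : ℂ)).IsHermitian :=
    Matrix.isHermitian_diagonal_iff.2 fun i => Complex.conj_ofReal (d i)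
  refine vonNeumannEntropy_eq_of_charpoly_eq (Matrix.isHermitian_mul_mul_conjTranspose U hdiag) ?_
  rw [Matrix.mul_assoc, Matrix.charpoly_mul_comm, Matrix.mul_assoc, hU, Matrix.mul_one,
    Matrix.charpoly_diagonal]

theorem exists_eq_conj_diagonal_eigenvalues {𝕜 : Type*} [RCLike 𝕜] {ρ : Matrix B B 𝕜}
    (hρ : ρ.IsHermitian) :
    ∃ U : Matrix B B 𝕜, Uᴴ * U = 1 ∧
      ρ = U * diagonal (fun i => (hρ.eigenvalues i : 𝕜)) * Uᴴ :=
  ⟨hρ.eigenvectorUnitary, Unitary.coe_star_mul_self _,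
    hρ.spectral_theorem.trans (Unitary.conjStarAlgAut_apply _ _)⟩

theorem vonNeumannEntropy_smul (c : ℝ) {ρ : Matrix B B ℂ} (hρ : ρ.IsHermitian) :
    vonNeumannEntropy ((c : ℂ) • ρ)
      = c * vonNeumannEntropy ρ + ρ.trace.re * (Real.negMulLog c / Real.log 2) := by
  obtain ⟨U, hU, hdiag⟩ := exists_eq_conj_diagonal_eigenvalues hρ
  have hsmul : (c : ℂ) • ρ
      = U * diagonal (fun i => ((c * hρ.eigenvalues i : ℝ) : ℂ)) * Uᴴ := by
    conv_lhs => rw [hdiag, ← Matrix.smul_mul, ← Matrix.mul_smul, ← Matrix.diagonal_smul]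
    simp only [Complex.ofReal_mul]
    rfl
  have htrace : ρ.trace.re = ∑ i, hρ.eigenvalues i := by
    rw [hρ.trace_eq_sum_eigenvalues]
    simp
  rw [hsmul, vonNeumannEntropy_conj_diagonal hU, shannonEntropy_const_mul, htrace,
    vonNeumannEntropy_eq_shannonEntropy_eigenvalues hρ]

theorem vonNeumannEntropy_blockDiagonal {L : Type*} [Fintype L] [DecidableEq L]
    {ρ : L → Matrix B B ℂ} (hρ : ∀ l, (ρ l).IsHermitian) :
    vonNeumannEntropy (blockDiagonal ρ) = ∑ l, vonNeumannEntropy (ρ l) := by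
  choose U hU hdiag using fun l => exists_eq_conj_diagonal_eigenvalues (hρ l)
  have hunitary : (blockDiagonal U)ᴴ * blockDiagonal U = 1 := by
    rw [Matrix.blockDiagonal_conjTranspose, ← Matrix.blockDiagonal_mul, funext hU]
    exact Matrix.blockDiagonal_one
  have hconj : blockDiagonal ρ = blockDiagonal U
      * diagonal (fun i : B × L => ((hρ i.2).eigenvalues i.1 : ℂ)) * (blockDiagonal U)ᴴ := by
    rw [← Matrix.blockDiagonal_diagonal fun l b => ((hρ l).eigenvalues b : ℂ),
      Matrix.blockDiagonal_conjTranspose, ← Matrix.blockDiagonal_mul, ← Matrix.blockDiagonal_mul]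
    exact congrArg blockDiagonal (funext hdiag)
  rw [hconj, vonNeumannEntropy_conj_diagonal hunitary fun i => (hρ i.2).eigenvalues i.1,
    shannonEntropy_prod_type fun l => (hρ l).eigenvalues]
  simp only [vonNeumannEntropy_eq_shannonEntropy_eigenvalues (hρ _)]

theorem vonNeumannEntropy_piKronecker {ι : Type*} {A : ι → Type*} [Fintype ι] [DecidableEq ι]
    [∀ k, Fintype (A k)] [∀ k, DecidableEq (A k)] {ρ : ∀ k, Matrix (A k) (A k) ℂ}
    (hρ : ∀ k, IsDensityMatrix (ρ k)) :
    vonNeumannEntropy (piKronecker ρ) = ∑ k, vonNeumannEntropy (ρ k) := by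
  have hherm : ∀ k, (ρ k).IsHermitian := fun k => (hρ k).posSemidef.isHermitian
  choose U hU hdiag using fun k => exists_eq_conj_diagonal_eigenvalues (hherm k)
  have hunitary : (piKronecker U)ᴴ * piKronecker U = 1 := by
    rw [conjTranspose_piKronecker, piKronecker_mul, funext hU, piKronecker_one]
  have hconj : piKronecker ρ = piKronecker U
      * diagonal (fun a => ((∏ k, (hherm k).eigenvalues (a k) : ℝ) : ℂ)) * (piKronecker U)ᴴ := by
    simp only [Complex.ofReal_prod]
    rw [← piKronecker_diagonal fun k a => ((hherm k).eigenvalues a : ℂ),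
      conjTranspose_piKronecker, piKronecker_mul, piKronecker_mul]
    exact congrArg piKronecker (funext hdiag)
  rw [hconj, vonNeumannEntropy_conj_diagonal hunitary,
    shannonEntropy_prod _ fun k => (hρ k).sum_eigenvalues]
  simp only [vonNeumannEntropy_eq_shannonEntropy_eigenvalues (hherm _)]

end VonNeumannEntropy

namespace Ensemble

section OfFintype

variable {A X : Type*} [Fintype A] [Fintype X]

/-- The ensemble `(p x, ρ x)` indexed by an arbitrary finite type `X`, transported to `Fin` along
an unspecified enumeration of `X`. -/
noncomputable def ofFintype (p : X → ℝ) (hp : p ∈ stdSimplex ℝ X) (ρ : X → Matrix A A ℂ)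
    (hρ : ∀ x, IsDensityMatrix (ρ x)) : Ensemble A where
  size := Fintype.card X
  prob i := p ((Fintype.equivFin X).symm i)
  prob_mem := ⟨fun _ => hp.1 _, ((Fintype.equivFin X).symm.sum_comp p).trans hp.2⟩
  state i := ρ ((Fintype.equivFin X).symm i)
  isDensityMatrix_state _ := hρ _

variable {p : X → ℝ} (hp : p ∈ stdSimplex ℝ X) {ρ : X → Matrix A A ℂ}
  (hρ : ∀ x, IsDensityMatrix (ρ x))

theorem average_ofFintype : (ofFintype p hp ρ hρ).average = ∑ x, (p x : ℂ) • ρ x :=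
  (Fintype.equivFin X).symm.sum_comp fun x => (p x : ℂ) • ρ x

theorem sum_prob_mul_ofFintype (f : Matrix A A ℂ → ℝ) :
    ∑ i, (ofFintype p hp ρ hρ).prob i * f ((ofFintype p hp ρ hρ).state i)
      = ∑ x, p x * f (ρ x) :=
  (Fintype.equivFin X).symm.sum_comp fun x => p x * f (ρ x)

end OfFintype

section Tensor

variable {ι A : Type*} [Fintype ι] [DecidableEq ι] [Fintype A]

/-- The product ensemble `⨂ k, E k`: independent draws from the ensembles `E k`. -/
noncomputable def tensor (E : ι → Ensemble A) : Ensemble (ι → A) :=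
  ofFintype (fun x : ∀ k, Fin (E k).size => ∏ k, (E k).prob (x k))
    (prod_mem_stdSimplex fun k => (E k).prob_mem)
    (fun x => piKronecker fun k => (E k).state (x k))
    fun x => IsDensityMatrix.piKronecker fun k => (E k).isDensityMatrix_state (x k)

theorem average_tensor (E : ι → Ensemble A) :
    (tensor E).average = piKronecker fun k => (E k).average := by
  rw [tensor, average_ofFintype]
  simp only [average, piKronecker_sum, piKronecker_smul, Complex.ofReal_prod]

end Tensor

end Ensemble

namespace QuantumChannel

section Tensor

variable {ι A B : Type*} [Fintype ι] [DecidableEq ι] [Fintype A] [DecidableEq A] [Fintype B]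
  [DecidableEq B]

theorem vonNeumannEntropy_tensor_piKronecker (C : ι → QuantumChannel A B)
    {ρ : ι → Matrix A A ℂ} (hρ : ∀ k, IsDensityMatrix (ρ k)) :
    vonNeumannEntropy ((tensor C).toLinearMap (piKronecker ρ))
      = ∑ k, vonNeumannEntropy ((C k).toLinearMap (ρ k)) := by
  rw [← vonNeumannEntropy_piKronecker fun k => (C k).isDensityMatrix_apply (hρ k)]
  exact congrArg vonNeumannEntropy (tensorLinearMap_apply_prod C ρ)

theorem holevoQuantity_tensor (C : ι → QuantumChannel A B) (E : ι → Ensemble A) :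
    (tensor C).holevoQuantity (Ensemble.tensor E) = ∑ k, (C k).holevoQuantity (E k) := by
  have haverage : vonNeumannEntropy ((tensor C).toLinearMap (Ensemble.tensor E).average)
      = ∑ k, vonNeumannEntropy ((C k).toLinearMap (E k).average) := by
    rw [Ensemble.average_tensor]
    exact vonNeumannEntropy_tensor_piKronecker C fun k => (E k).isDensityMatrix_average
  have hstates : ∑ i, (Ensemble.tensor E).prob i
        * vonNeumannEntropy ((tensor C).toLinearMap ((Ensemble.tensor E).state i))
      = ∑ k, ∑ x, (E k).prob x * vonNeumannEntropy ((C k).toLinearMap ((E k).state x)) := by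
    rw [← sum_prod_mul_sum _ (fun k x => vonNeumannEntropy ((C k).toLinearMap ((E k).state x)))
      fun k => (E k).prob_mem.2]
    simp only [← vonNeumannEntropy_tensor_piKronecker C fun k => (E k).isDensityMatrix_state _]
    exact Ensemble.sum_prob_mul_ofFintype _ _ fun σ =>
      vonNeumannEntropy ((tensor C).toLinearMap σ)
  simp only [holevoQuantity, haverage, hstates, Finset.sum_sub_distrib]

end Tensor

section HolevoInformation

variable {A B : Type*} [Fintype A] [DecidableEq A] [Fintype B] [DecidableEq B]

theorem holevoQuantity_le_holevoInformation (N : QuantumChannel A B) (E : Ensemble A) :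
    N.holevoQuantity E ≤ N.holevoInformation :=
  le_ciSup N.bddAbove_holevoQuantity E

theorem holevoInformation_eq_of_eq_submatrix {D : Type*} [Fintype D] [DecidableEq D]
    {M : QuantumChannel A B} {N : QuantumChannel A D} (e : B ≃ D)
    (h : ∀ X, M.toLinearMap X = (N.toLinearMap X).submatrix e e) :
    M.holevoInformation = N.holevoInformation := by
  have hentropy : ∀ {ρ}, IsDensityMatrix ρ →
      vonNeumannEntropy (M.toLinearMap ρ) = vonNeumannEntropy (N.toLinearMap ρ) := fun hρ => by
    rw [h, vonNeumannEntropy_submatrix_equiv (N.isDensityMatrix_apply hρ).posSemidef.isHermitian]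
  refine iSup_congr fun E => ?_
  simp only [holevoQuantity, hentropy E.isDensityMatrix_average,
    hentropy (E.isDensityMatrix_state _)]

theorem tendsto_holevoInformation_tensorPower_div {N : QuantumChannel A B}
    (hN : ∀ n : ℕ, (N.tensorPower n).holevoInformation = n * N.holevoInformation) :
    Tendsto (fun n : ℕ => (N.tensorPower n).holevoInformation / n) atTop
      (𝓝 N.holevoInformation) := by
  refine tendsto_const_nhds.congr' ?_
  filter_upwards [eventually_ne_atTop 0] with n hn
  rw [hN, mul_div_cancel_left₀ _ (Nat.cast_ne_zero.2 hn)]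

end HolevoInformation

section LabeledRandom

variable {ι A B L : Type*} [Fintype A] [DecidableEq A] [Fintype B] [Fintype L] [DecidableEq L]

theorem labeledRandomLinearMap_eq_blockDiagonal (p : L → ℝ) (C : L → QuantumChannel A B)
    (X : Matrix A A ℂ) :
    labeledRandomLinearMap p C X = blockDiagonal fun l => (p l : ℂ) • (C l).toLinearMap X := by
  simp only [← sum_kronecker_single_eq_blockDiagonal, Matrix.smul_kronecker]
  rfl

theorem tensor_labeledRandom_apply [Fintype ι] [DecidableEq ι] {p : ι → L → ℝ}
    (hp : ∀ k, p k ∈ stdSimplex ℝ L) (C : ι → L → QuantumChannel A B)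
    (X : Matrix (ι → A) (ι → A) ℂ) :
    (tensor fun k => labeledRandom (p k) (hp k) (C k)).toLinearMap X
      = ((labeledRandom _ (prod_mem_stdSimplex hp) fun w =>
          tensor fun k => C k (w k)).toLinearMap X).submatrix
        (Equiv.arrowProdEquivProdArrow ι (fun _ => B) fun _ => L)
        (Equiv.arrowProdEquivProdArrow ι (fun _ => B) fun _ => L) := by
  ext b b'
  simp only [tensor, labeledRandom, labeledRandomLinearMap_eq_blockDiagonal, tensorLinearMap,
    LinearMap.coe_mk, AddHom.coe_mk, Matrix.submatrix_apply, Matrix.of_apply,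
    Matrix.blockDiagonal_apply, Matrix.smul_apply, smul_eq_mul, Finset.prod_ite_zero,
    Finset.mem_univ, true_imp_iff, Equiv.arrowProdEquivProdArrow, Equiv.coe_fn_mk, funext_iff]
  split_ifs
  · simp only [Finset.prod_mul_distrib, Finset.mul_sum, Complex.ofReal_prod, mul_left_comm]
  · simp only [mul_zero, Finset.sum_const_zero]

variable [DecidableEq B] {p : L → ℝ} (hp : p ∈ stdSimplex ℝ L) (C : L → QuantumChannel A B)

theorem vonNeumannEntropy_labeledRandom {ρ : Matrix A A ℂ} (hρ : IsDensityMatrix ρ) :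
    vonNeumannEntropy ((labeledRandom p hp C).toLinearMap ρ)
      = shannonEntropy p + ∑ l, p l * vonNeumannEntropy ((C l).toLinearMap ρ) := by
  have houtput : ∀ l, IsDensityMatrix ((C l).toLinearMap ρ) := fun l =>
    (C l).isDensityMatrix_apply hρ
  have hherm : ∀ l, ((C l).toLinearMap ρ).IsHermitian := fun l => (houtput l).posSemidef.isHermitian
  have hblock : ∀ l, ((p l : ℂ) • (C l).toLinearMap ρ).IsHermitian := fun l =>
    (hherm l).smul (Complex.conj_ofReal (p l))
  calc vonNeumannEntropy ((labeledRandom p hp C).toLinearMap ρ)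
      = vonNeumannEntropy (blockDiagonal fun l => (p l : ℂ) • (C l).toLinearMap ρ) :=
        congrArg vonNeumannEntropy (labeledRandomLinearMap_eq_blockDiagonal p C ρ)
    _ = ∑ l, (p l * vonNeumannEntropy ((C l).toLinearMap ρ)
          + Real.negMulLog (p l) / Real.log 2) := by
        simp only [vonNeumannEntropy_blockDiagonal hblock, vonNeumannEntropy_smul _ (hherm _),
          (houtput _).trace_eq_one, Complex.one_re, one_mul]
    _ = shannonEntropy p + ∑ l, p l * vonNeumannEntropy ((C l).toLinearMap ρ) := by
        rw [Finset.sum_add_distrib, add_comm, shannonEntropy, Finset.sum_div]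

theorem holevoQuantity_labeledRandom (E : Ensemble A) :
    (labeledRandom p hp C).holevoQuantity E = ∑ l, p l * (C l).holevoQuantity E := by
  have hstates : ∑ x, E.prob x * ∑ l, p l * vonNeumannEntropy ((C l).toLinearMap (E.state x))
      = ∑ l, p l * ∑ x, E.prob x * vonNeumannEntropy ((C l).toLinearMap (E.state x)) := by
    simp only [Finset.mul_sum]
    rw [Finset.sum_comm]
    simp only [mul_left_comm]
  simp only [holevoQuantity, vonNeumannEntropy_labeledRandom hp C E.isDensityMatrix_average,
    vonNeumannEntropy_labeledRandom hp C (E.isDensityMatrix_state _), mul_add,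
    Finset.sum_add_distrib, ← Finset.sum_mul, E.prob_mem.2, one_mul, hstates, mul_sub,
    Finset.sum_sub_distrib, add_sub_add_left_eq_sub]

theorem holevoInformation_labeledRandom {E : Ensemble A}
    (hE : ∀ l, (C l).holevoQuantity E = (C l).holevoInformation) :
    (labeledRandom p hp C).holevoInformation = ∑ l, p l * (C l).holevoInformation := by
  have : Nonempty (Ensemble A) := ⟨E⟩
  refine le_antisymm (ciSup_le fun E' => ?_) ?_
  · rw [holevoQuantity_labeledRandom]
    exact Finset.sum_le_sum fun l _ =>
      mul_le_mul_of_nonneg_left ((C l).holevoQuantity_le_holevoInformation E') (hp.1 l)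
  · simp only [← hE]
    rw [← holevoQuantity_labeledRandom hp C]
    exact holevoQuantity_le_holevoInformation _ E

theorem holevoInformation_tensor_labeledRandom [Fintype ι] [DecidableEq ι] {p : ι → L → ℝ}
    (hp : ∀ k, p k ∈ stdSimplex ℝ L) (C : ι → L → QuantumChannel A B) {E : ι → Ensemble A}
    (hE : ∀ k l, (C k l).holevoQuantity (E k) = (C k l).holevoInformation)
    (hC : ∀ w : ι → L,
      (tensor fun k => C k (w k)).holevoInformation = ∑ k, (C k (w k)).holevoInformation) :
    (tensor fun k => labeledRandom (p k) (hp k) (C k)).holevoInformation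
      = ∑ k, (labeledRandom (p k) (hp k) (C k)).holevoInformation := by
  have hoptimal : ∀ w : ι → L, (tensor fun k => C k (w k)).holevoQuantity (Ensemble.tensor E)
      = (tensor fun k => C k (w k)).holevoInformation := fun w => by
    simp only [holevoQuantity_tensor, hE, hC]
  rw [holevoInformation_eq_of_eq_submatrix _ (tensor_labeledRandom_apply hp C),
    holevoInformation_labeledRandom _ _ hoptimal]
  simp only [hC, holevoInformation_labeledRandom (hp _) (C _) (hE _)]
  exact sum_prod_mul_sum p (fun k l => (C k l).holevoInformation) fun k => (hp k).2

theorem holevoInformation_tensorPower_labeledRandom {E : Ensemble A}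
    (hE : ∀ l, (C l).holevoQuantity E = (C l).holevoInformation) (hC : HolevoAdditive C)
    (n : ℕ) :
    ((labeledRandom p hp C).tensorPower n).holevoInformation
      = n * (labeledRandom p hp C).holevoInformation := by
  rw [tensorPower, holevoInformation_tensor_labeledRandom _ _ (fun _ => hE) (hC n), Fin.sum_const,
    nsmul_eq_mul]

end LabeledRandom

end QuantumChannel

/-- If one ensemble `E` attains the Holevo information of every `C l`, then the labeled random
channel has Holevo information `∑ l, p l * χ(C l)`; if moreover Holevo additivity holds among the
`C l`, the limit defining its classical capacity exists and equals its Holevo information. -/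
theorem mainTheorem7 {A B L : Type*} [Fintype A] [DecidableEq A] [Fintype B] [DecidableEq B]
    [Fintype L] [DecidableEq L] (C : L → QuantumChannel A B)
    (p : L → ℝ) (hp : p ∈ stdSimplex ℝ L)
    (hfixed : ∃ E : Ensemble A, ∀ l, (C l).holevoQuantity E = (C l).holevoInformation) :
    (QuantumChannel.labeledRandom p hp C).holevoInformation
        = ∑ l, p l * (C l).holevoInformation ∧
      (QuantumChannel.HolevoAdditive C →
        Tendsto (fun n : ℕ =>
            ((QuantumChannel.labeledRandom p hp C).tensorPower n).holevoInformation / n)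
          atTop (𝓝 (QuantumChannel.labeledRandom p hp C).classicalCapacity) ∧
        (QuantumChannel.labeledRandom p hp C).classicalCapacity
          = (QuantumChannel.labeledRandom p hp C).holevoInformation) := by
  obtain ⟨E, hE⟩ := hfixed
  refine ⟨QuantumChannel.holevoInformation_labeledRandom hp C hE, fun hC => ?_⟩
  have hlim := QuantumChannel.tendsto_holevoInformation_tensorPower_div
    (QuantumChannel.holevoInformation_tensorPower_labeledRandom hp C hE hC)
  have hcapacity : (QuantumChannel.labeledRandom p hp C).classicalCapacity
      = (QuantumChannel.labeledRandom p hp C).holevoInformation := hlim.limUnder_eq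
  exact ⟨hcapacity ▸ hlim, hcapacity⟩
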